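/- Let $N\ge 1$, let $\mathcal E_1,\dots,\mathcal E_N$ be real numbers with $\sum_{i}\mathcal E_i=0$, and let $A=-i\,\mathrm{diag}(\mathcal E_1,\dots,\mathcal E_N)$. Let $B=[b_{ij}]\in\mathfrak{su}(N)$ be a traceless skew-Hermitian $N\times N$ matrix, and let $\mathcal G_B$ be the graph with nodes $1,\dots,N$ and an arc $(i,j)$ whenever $b_{ij}\neq 0$. Assume that $\mathcal G_B$ is connected and that $A$ is regular in the following sense: the transitions $\mathcal E_j-\mathcal E_i$, taken over all ordered pairs $(i,j)$ with $i\neq j$, are nonzero and pairwise distinct, i.e. $\mathcal E_j-\mathcal E_i\neq\mathcal E_l-\mathcal E_k$ whenever $i\neq j$, $k\neq l$ and $(i,j)\neq(k,l)$. Then the control system $$\dot X(t)=\bigl(A+u(t)B\bigr)X(t),\qquad X(0)=I,\qquad X(t)\in SU(N),$$ is controllable: for every $\bar X\in SU(N)$ there are a time $T\ge 0$ and a piecewise constant input $u:[0,T]\to\mathbb R$ such that the corresponding (continuous, piecewise differentiable) solution satisfies $X(T)=\bar X$. -/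

import Mathlib

open scoped Matrix Topology

namespace QuantumControl

/-- The real vector space (Lie algebra) `𝔰𝔲(N)` of traceless skew-Hermitian `N × N` complex matrices. -/
def su (N : ℕ) : Submodule ℝ (Matrix (Fin N) (Fin N) ℂ) where
  carrier := {X | Xᴴ = -X ∧ X.trace = 0}
  zero_mem' := by simp
  add_mem' := by
    rintro X Y ⟨hX, hX'⟩ ⟨hY, hY'⟩
    refine ⟨?_, ?_⟩
    · rw [Matrix.conjTranspose_add, hX, hY, neg_add]
    · rw [Matrix.trace_add, hX', hY', add_zero]
  smul_mem' := by
    rintro c X ⟨hX, hX'⟩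
    refine ⟨?_, ?_⟩
    · rw [Matrix.conjTranspose_smul, hX, star_trivial, smul_neg]
    · rw [Matrix.trace_smul, hX', smul_zero]

/-- The diagonal drift `A = -i H₀`, where `H₀ = diag(E₁, …, E_N)` is the free Hamiltonian
with energy levels `E` (in units with `ℏ = 1`). -/
noncomputable def drift {N : ℕ} (E : Fin N → ℝ) : Matrix (Fin N) (Fin N) ℂ :=
  Matrix.diagonal fun j => -Complex.I * (E j : ℂ)

/-- The diagonal drift with energy levels `E` is regular: the energy transitions `E j - E i`,
over all ordered pairs of different indices (that is, the values of all the roots), are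
nonzero and pairwise distinct. -/
def IsRegularDrift {N : ℕ} (E : Fin N → ℝ) : Prop :=
  (∀ i j, i ≠ j → E j - E i ≠ 0) ∧
    ∀ i j k l, i ≠ j → k ≠ l → (i, j) ≠ (k, l) → E j - E i ≠ E l - E k

/-- The graph of a square matrix `B`: there is an arc from `i` to `j` whenever `B i j ≠ 0`
(loops included). -/
def matrixGraph {N : ℕ} (B : Matrix (Fin N) (Fin N) ℂ) : Digraph (Fin N) where
  Adj i j := B i j ≠ 0

/-- The graph of `B` is connected, as an undirected graph. For skew-Hermitian `B` this is the
same as strong connectedness, because then `B i j ≠ 0` if and only if `B j i ≠ 0`. -/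
def GraphConnected {N : ℕ} (B : Matrix (Fin N) (Fin N) ℂ) : Prop :=
  (matrixGraph B).toSimpleGraphInclusive.Connected

/-- `X` is an integral curve on `[0, T]`, in `SU(N)` and starting at the identity, of
`X'(t) = (A + u(t) B) X(t)`, for the input `u` that is piecewise constant on `[0, T]`: away from
a finite set of switching times `u` is locally constant and the equation holds, and `X` is
continuous on all of `[0, T]`. -/
def IsTrajectory {N : ℕ} (A B : Matrix (Fin N) (Fin N) ℂ) (T : ℝ) (u : ℝ → ℝ)
    (X : ℝ → Matrix (Fin N) (Fin N) ℂ) : Prop :=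
  ContinuousOn X (Set.Icc 0 T) ∧
    (∀ t ∈ Set.Icc 0 T, X t ∈ Matrix.specialUnitaryGroup (Fin N) ℂ) ∧
    X 0 = 1 ∧
    ∃ S : Finset ℝ, ∀ t ∈ Set.Ioo 0 T, t ∉ S →
      (∀ᶠ s in 𝓝 t, u s = u t) ∧ HasDerivAt X ((A + u t • B) * X t) t

/-- The set of all points of `SU(N)` that are reached from the identity, in some time `T ≥ 0`,
by means of some piecewise constant real input. -/
def reachableSet {N : ℕ} (A B : Matrix (Fin N) (Fin N) ℂ) :
    Set (Matrix.specialUnitaryGroup (Fin N) ℂ) :=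
  {Y | ∃ T : ℝ, 0 ≤ T ∧ ∃ (u : ℝ → ℝ) (X : ℝ → Matrix (Fin N) (Fin N) ℂ),
    IsTrajectory A B T u X ∧ X T = Y}

/-- The system `X'(t) = (A + u(t) B) X(t)`, `X(0) = I`, on `SU(N)` is (globally) controllable. -/
def Controllable {N : ℕ} (A B : Matrix (Fin N) (Fin N) ℂ) : Prop :=
  reachableSet A B = Set.univ

end QuantumControl

/-!
Let `L` be the Lie algebra generated by `A = drift E` and `B`. The entry `(k, l)` is an eigenvector
of `(ad A)²` with eigenvalue `-(E k - E l)²`; as the transitions along the edges of the graph of `B`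
are distinct, a polynomial in `(ad A)²` isolates the component of `B` on any single edge, and a
further bracket with `A` turns its phase. Brackets along paths of the connected graph then produce
all of `𝔰𝔲(N)`.

That `L = 𝔰𝔲(N)` suffices is the theorem of Jurdjevic and Sussmann. Among the points `g` of the
monoid `S` generated by the flows, choose one through which passes a family in `S` whose space of
velocities `V` has maximal dimension. Extending the family by further flows cannot enlarge `V`, and
this invariance forces `g * L ⊆ V`; hence `S` contains a neighbourhood of `g` in `SU(N)`. Since
`SU(N)` is compact, inverses are limits of powers, so `S` contains a neighbourhood of `1` as well,
and therefore, the exponential map being surjective, all of `SU(N)`.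
-/

open Filter NormedSpace

namespace QuantumControl

section LieGeneration

attribute [local instance] LieRing.ofAssociativeRing

theorem lieSpan_toSubmodule_le {R L : Type*} [CommRing R] [LieRing L] [LieAlgebra R L] {s : Set L}
    {W : Submodule R L} (hs : s ⊆ W) (hlie : ∀ x ∈ s, ∀ w ∈ W, ⁅x, w⁆ ∈ W) :
    (LieSubalgebra.lieSpan R L s).toSubmodule ≤ W := by
  suffices h : ∀ x ∈ LieSubalgebra.lieSpan R L s, x ∈ W ∧ ∀ w ∈ W, ⁅x, w⁆ ∈ W from
    fun x hx => (h x hx).1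
  intro x hx
  induction hx using LieSubalgebra.lieSpan_induction with
  | mem x hx => exact ⟨hs hx, hlie x hx⟩
  | zero => exact ⟨W.zero_mem, fun w _ => by simp only [zero_lie, W.zero_mem]⟩
  | smul r x _ h =>
    exact ⟨W.smul_mem r h.1, fun w hw => by rw [smul_lie]; exact W.smul_mem r (h.2 w hw)⟩
  | add x y _ _ hx hy =>
    exact ⟨W.add_mem hx.1 hy.1, fun w hw => by
      rw [add_lie]; exact W.add_mem (hx.2 w hw) (hy.2 w hw)⟩
  | lie x y _ _ hx hy =>
    exact ⟨hx.2 y hy.1, fun w hw => by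
      rw [lie_lie]; exact W.sub_mem (hx.2 _ (hy.2 w hw)) (hy.2 _ (hx.2 w hw))⟩

variable {n : Type*} [DecidableEq n]

/-- The skew-Hermitian matrix `z E_{ij} - z̄ E_{ji}`, as a real linear function of `z`. For `i ≠ j`
these matrices are the components of `𝔰𝔲(N)` in the root spaces of the diagonal matrices. -/
noncomputable def skewSingle (i j : n) : ℂ →ₗ[ℝ] Matrix n n ℂ :=
  Matrix.singleLinearMap ℝ i j - Matrix.singleLinearMap ℝ j i ∘ₗ Complex.conjAe.toLinearMap

theorem skewSingle_apply (i j : n) (z : ℂ) :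
    skewSingle i j z = Matrix.single i j z - Matrix.single j i (star z) :=
  rfl

theorem sum_skewSingle_of_conjTranspose_eq_neg [Fintype n] {X : Matrix n n ℂ} (hX : Xᴴ = -X) :
    ∑ i, ∑ j, skewSingle i j (X i j) = (2 : ℝ) • X := by
  have hstar : ∑ i, ∑ j, Matrix.single j i (star (X i j)) = Xᴴ := by
    rw [Finset.sum_comm]
    exact (Matrix.matrix_eq_sum_single Xᴴ).symm
  simp only [skewSingle_apply, Finset.sum_sub_distrib]
  rw [← Matrix.matrix_eq_sum_single, hstar, hX, sub_neg_eq_add, two_smul]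

theorem lie_skewSingle_skewSingle [Fintype n] {i j k : n} (hij : i ≠ j) (hjk : j ≠ k) (hik : i ≠ k)
    (z w : ℂ) : ⁅skewSingle i j z, skewSingle j k w⁆ = skewSingle i k (z * w) := by
  simp [skewSingle_apply, Ring.lie_def, mul_sub, sub_mul, hij, hjk, hik, hij.symm, hjk.symm,
    hik.symm, mul_comm]

theorem lie_skewSingle_one [Fintype n] (i j : n) (z : ℂ) :
    ⁅skewSingle i j 1, skewSingle i j z⁆ = skewSingle i i z - skewSingle j j z := by
  rcases eq_or_ne i j with rfl | hij
  · simp [skewSingle_apply]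
  · simp only [skewSingle_apply, Ring.lie_def, mul_sub, sub_mul, Matrix.single_mul_single_same,
      ne_eq, hij, hij.symm, not_false_eq_true, Matrix.single_mul_single_of_ne, star_one, one_mul,
      mul_one]
    abel

theorem mem_of_map_mem_of_map_I_mul_mem {M : Type*} [AddCommGroup M] [Module ℝ M]
    {V : Submodule ℝ M} (f : ℂ →ₗ[ℝ] M) {b : ℂ} (hb : b ≠ 0) (h : f b ∈ V)
    (hI : f (Complex.I * b) ∈ V) (z : ℂ) : f z ∈ V := by
  have hz : z = (z / b).re • b + (z / b).im • (Complex.I * b) := by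
    rw [Complex.real_smul, Complex.real_smul, ← mul_assoc, ← add_mul, Complex.re_add_im,
      div_mul_cancel₀ _ hb]
  rw [hz, map_add, map_smul, map_smul]
  exact V.add_mem (V.smul_mem _ h) (V.smul_mem _ hI)

theorem su_le_of_skewSingle_mem {N : ℕ} {L : LieSubalgebra ℝ (Matrix (Fin N) (Fin N) ℂ)}
    (h : ∀ i j, i ≠ j → ∀ z, skewSingle i j z ∈ L) : su N ≤ L.toSubmodule := by
  intro X hX
  obtain hN | ⟨⟨k⟩⟩ := isEmpty_or_nonempty (Fin N)
  · rw [Subsingleton.elim X 0]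
    exact L.zero_mem
  have hk : ∑ i : Fin N, skewSingle k k (X i i) = 0 := by
    rw [← map_sum, show ∑ i, X i i = 0 from hX.2, map_zero]
  have hsub (i : Fin N) : skewSingle i i (X i i) - skewSingle k k (X i i) ∈ L := by
    rcases eq_or_ne i k with rfl | hik
    · rw [sub_self]
      exact L.zero_mem
    · rw [← lie_skewSingle_one]
      exact L.lie_mem (h i k hik 1) (h i k hik _)
  have hdiag : ∑ i : Fin N, skewSingle i i (X i i) ∈ L := by
    rw [← sub_zero (∑ i : Fin N, skewSingle i i (X i i)), ← hk, ← Finset.sum_sub_distrib]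
    exact sum_mem fun i _ => hsub i
  have hoff : ∑ i : Fin N, ∑ j ∈ Finset.univ.erase i, skewSingle i j (X i j) ∈ L :=
    sum_mem fun i _ => sum_mem fun j hj => h i j (Finset.ne_of_mem_erase hj).symm _
  have hsum : (2 : ℝ) • X ∈ L.toSubmodule := by
    rw [← sum_skewSingle_of_conjTranspose_eq_neg hX.1]
    have hsplit (i : Fin N) : ∑ j, skewSingle i j (X i j) = skewSingle i i (X i i) +
        ∑ j ∈ Finset.univ.erase i, skewSingle i j (X i j) :=
      (Finset.add_sum_erase Finset.univ _ (Finset.mem_univ i)).symm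
    simp only [hsplit, Finset.sum_add_distrib]
    exact L.add_mem hdiag hoff
  exact (L.toSubmodule.smul_mem_iff two_ne_zero).1 hsum

theorem lie_drift_apply {N : ℕ} (E : Fin N → ℝ) (X : Matrix (Fin N) (Fin N) ℂ) (k l : Fin N) :
    ⁅drift E, X⁆ k l = -Complex.I * (E k - E l) * X k l := by
  rw [Ring.lie_def, Matrix.sub_apply, drift, Matrix.diagonal_mul, Matrix.mul_diagonal]
  ring

theorem lie_drift_single {N : ℕ} (E : Fin N → ℝ) (i j : Fin N) (z : ℂ) :
    ⁅drift E, Matrix.single i j z⁆ = (E j - E i) • Matrix.single i j (Complex.I * z) := by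
  ext k l
  rw [lie_drift_apply, Matrix.smul_apply, Complex.real_smul, Matrix.single_apply,
    Matrix.single_apply]
  split_ifs with h
  · rw [h.1, h.2]
    push_cast
    ring
  · rw [mul_zero, mul_zero]

theorem lie_drift_skewSingle {N : ℕ} (E : Fin N → ℝ) (i j : Fin N) (z : ℂ) :
    ⁅drift E, skewSingle i j z⁆ = (E j - E i) • skewSingle i j (Complex.I * z) := by
  have hneg : E i - E j = -(E j - E i) := (neg_sub _ _).symm
  have hstar : star (Complex.I * z) = -(Complex.I * star z) := by simp
  rw [skewSingle_apply, skewSingle_apply, lie_sub, lie_drift_single, lie_drift_single, smul_sub,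
    hneg, hstar, neg_smul, ← smul_neg, Matrix.single_neg]

theorem eval_smul_mem_of_lie_drift_mem {N : ℕ} {E : Fin N → ℝ}
    {V : Submodule ℝ (Matrix (Fin N) (Fin N) ℂ)} (hV : ∀ X ∈ V, ⁅drift E, X⁆ ∈ V)
    {X : Matrix (Fin N) (Fin N) ℂ} (hX : X ∈ V) (p : Polynomial ℝ) :
    (Matrix.of fun k l => p.eval ((E k - E l) ^ 2) • X k l) ∈ V := by
  induction p using Polynomial.induction_on' with
  | add p q hp hq =>
    convert V.add_mem hp hq
    ext k l
    simp [add_mul]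
  | monomial m a =>
    have hpow : (Matrix.of fun k l => ((E k - E l) ^ 2) ^ m • X k l) ∈ V := by
      induction m with
      | zero =>
        convert hX
        ext k l
        simp
      | succ m ih =>
        convert V.neg_mem (hV _ (hV _ ih))
        ext k l
        simp only [Matrix.of_apply, Matrix.neg_apply, lie_drift_apply, Complex.real_smul]
        push_cast
        linear_combination ((E k : ℂ) - E l) ^ 2 * (((E k : ℂ) - E l) ^ 2) ^ m * X k l *
          Complex.I_sq
    convert V.smul_mem a hpow
    ext k l
    simp [mul_assoc]

theorem apply_eq_neg_star_of_conjTranspose_eq_neg {n : Type*} {X : Matrix n n ℂ} (hX : Xᴴ = -X)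
    (i j : n) : X j i = -star (X i j) := by
  rw [← X.conjTranspose_apply, hX, Matrix.neg_apply, neg_neg]

theorem apply_ne_zero_of_conjTranspose_eq_neg {n : Type*} {X : Matrix n n ℂ} (hX : Xᴴ = -X)
    {i j : n} (h : X i j ≠ 0) : X j i ≠ 0 := by
  rwa [apply_eq_neg_star_of_conjTranspose_eq_neg hX i j, neg_ne_zero, star_ne_zero]

/-- Regularity of the drift relative to `B`: the energy transitions along the edges of the graph
of `B` are pairwise distinct. Every edge is counted in both directions, so for skew-Hermitian `B`
these transitions are also nonzero. -/
def HasDistinctTransitions {N : ℕ} (E : Fin N → ℝ) (B : Matrix (Fin N) (Fin N) ℂ) : Prop :=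
  ∀ i j k l, i ≠ j → k ≠ l → B i j ≠ 0 → B k l ≠ 0 → (i, j) ≠ (k, l) → E j - E i ≠ E l - E k

variable {N : ℕ} {E : Fin N → ℝ} {B : Matrix (Fin N) (Fin N) ℂ}
  {L : LieSubalgebra ℝ (Matrix (Fin N) (Fin N) ℂ)} {i j : Fin N}

theorem HasDistinctTransitions.ne (hE : HasDistinctTransitions E B) (hB : Bᴴ = -B) (hij : i ≠ j)
    (hBij : B i j ≠ 0) : E i ≠ E j := fun h =>
  hE i j j i hij hij.symm hBij (apply_ne_zero_of_conjTranspose_eq_neg hB hBij)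
    (fun e => hij (congrArg Prod.fst e)) (by rw [h])

theorem HasDistinctTransitions.sq_ne (hE : HasDistinctTransitions E B) (hB : Bᴴ = -B)
    (hij : i ≠ j) (hBij : B i j ≠ 0) {k l : Fin N} (hBkl : B k l ≠ 0) (h : (k, l) ≠ (i, j))
    (h' : (k, l) ≠ (j, i)) : (E i - E j) ^ 2 ≠ (E k - E l) ^ 2 := by
  intro hsq
  rcases eq_or_ne k l with rfl | hkl
  · rw [sub_self, zero_pow two_ne_zero, sq_eq_zero_iff, sub_eq_zero] at hsq
    exact hE.ne hB hij hBij hsq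
  rcases sq_eq_sq_iff_eq_or_eq_neg.1 hsq with hsub | hsub
  · exact hE k l i j hkl hij hBkl hBij h (by linarith)
  · exact hE k l j i hkl hij.symm hBkl (apply_ne_zero_of_conjTranspose_eq_neg hB hBij) h'
      (by linarith)

theorem skewSingle_apply_mem (hE : HasDistinctTransitions E B) (hB : Bᴴ = -B)
    (hEL : drift E ∈ L) (hBL : B ∈ L) (hij : i ≠ j) (hBij : B i j ≠ 0) :
    skewSingle i j (B i j) ∈ L := by
  -- A polynomial in `(ad A)²` that kills every component of `B` except the one in question.
  set nodes : Finset ℝ := (Finset.univ.filter fun p : Fin N × Fin N => B p.1 p.2 ≠ 0).image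
    fun p => (E p.1 - E p.2) ^ 2
  have hmem {k l : Fin N} (h : B k l ≠ 0) : (E k - E l) ^ 2 ∈ nodes :=
    Finset.mem_image.2 ⟨(k, l), by simpa using h, rfl⟩
  set p := Lagrange.basis nodes id ((E i - E j) ^ 2)
  have hp : p.eval ((E i - E j) ^ 2) = 1 :=
    Lagrange.eval_basis_self Function.injective_id.injOn (hmem hBij)
  have hp' {k l : Fin N} (hBkl : B k l ≠ 0) (h : (k, l) ≠ (i, j)) (h' : (k, l) ≠ (j, i)) :
      p.eval ((E k - E l) ^ 2) = 0 :=
    Lagrange.eval_basis_of_ne (v := id) (hE.sq_ne hB hij hBij hBkl h h') (hmem hBkl)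
  have hL : ∀ X ∈ L.toSubmodule, ⁅drift E, X⁆ ∈ L.toSubmodule := fun X hX => L.lie_mem hEL hX
  rw [← LieSubalgebra.mem_toSubmodule]
  convert eval_smul_mem_of_lie_drift_mem hL hBL p using 1
  ext k l
  rw [skewSingle_apply, Matrix.sub_apply, Matrix.of_apply]
  by_cases h : (k, l) = (i, j)
  · obtain ⟨rfl, rfl⟩ := Prod.mk.inj h
    simp [hp, hij]
  by_cases h' : (k, l) = (j, i)
  · obtain ⟨rfl, rfl⟩ := Prod.mk.inj h'
    rw [← neg_sub (E l), neg_sq, hp, apply_eq_neg_star_of_conjTranspose_eq_neg hB l k]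
    simp [hij]
  · rw [Matrix.single_apply_of_ne _ _ _ _ _ (by grind),
      Matrix.single_apply_of_ne _ _ _ _ _ (by grind), sub_zero]
    by_cases hBkl : B k l = 0
    · rw [hBkl, smul_zero]
    · rw [hp' hBkl h h', zero_smul]

theorem skewSingle_mem (hE : HasDistinctTransitions E B) (hB : Bᴴ = -B)
    (hEL : drift E ∈ L) (hBL : B ∈ L) (hij : i ≠ j) (hBij : B i j ≠ 0) (z : ℂ) :
    skewSingle i j z ∈ L := by
  have hb := skewSingle_apply_mem hE hB hEL hBL hij hBij
  refine mem_of_map_mem_of_map_I_mul_mem (V := L.toSubmodule) (skewSingle i j) hBij hb ?_ z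
  have hlie := L.lie_mem hEL hb
  rw [lie_drift_skewSingle] at hlie
  exact (L.toSubmodule.smul_mem_iff (sub_ne_zero.2 (hE.ne hB hij hBij).symm)).1 hlie

theorem skewSingle_mem_of_walk {G : SimpleGraph (Fin N)}
    (hG : ∀ k l, G.Adj k l → ∀ z, skewSingle k l z ∈ L) (p : G.Walk i j) (hij : i ≠ j) (z : ℂ) :
    skewSingle i j z ∈ L := by
  induction p generalizing z with
  | nil => exact absurd rfl hij
  | @cons i k j hik p ih =>
    rcases eq_or_ne k j with rfl | hkj
    · exact hG _ _ hik z
    · rw [← one_mul z, ← lie_skewSingle_skewSingle hik.ne hkj hij]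
      exact L.lie_mem (hG _ _ hik 1) (ih hkj z)

theorem su_le_lieSpan_drift (hE : HasDistinctTransitions E B) (hB : Bᴴ = -B)
    (hconn : GraphConnected B) :
    su N ≤ (LieSubalgebra.lieSpan ℝ (Matrix (Fin N) (Fin N) ℂ) {drift E, B}).toSubmodule := by
  refine su_le_of_skewSingle_mem fun i j hij => ?_
  obtain ⟨p⟩ := hconn.preconnected i j
  refine skewSingle_mem_of_walk (fun k l hkl => ?_) p hij
  have hBkl : B k l ≠ 0 ∨ B l k ≠ 0 := by
    simpa [Digraph.toSimpleGraphInclusive, matrixGraph, hkl.ne] using hkl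
  exact skewSingle_mem hE hB (LieSubalgebra.subset_lieSpan (Set.mem_insert _ _))
    (LieSubalgebra.subset_lieSpan (Set.mem_insert_of_mem _ rfl)) hkl.ne
    (hBkl.elim id (apply_ne_zero_of_conjTranspose_eq_neg hB))

end LieGeneration

section Accessibility

variable {𝔸 : Type*} [NormedRing 𝔸] [NormedAlgebra ℝ 𝔸]

theorem exp_add_smul [CompleteSpace 𝔸] (s t : ℝ) (C : 𝔸) :
    exp ((s + t) • C) = exp (s • C) * exp (t • C) := by
  let _ : NormedAlgebra ℚ 𝔸 := NormedAlgebra.restrictScalars ℚ ℝ 𝔸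
  rw [add_smul, exp_add_of_commute (((Commute.refl C).smul_left s).smul_right t)]

theorem exp_smul_mul_exp_neg_smul [CompleteSpace 𝔸] (t : ℝ) (C : 𝔸) :
    exp (t • C) * exp (-t • C) = 1 := by
  rw [← exp_add_smul, add_neg_cancel, zero_smul, exp_zero]

theorem isUnit_exp_of_real [CompleteSpace 𝔸] (X : 𝔸) : IsUnit (exp X) := by
  let _ : NormedAlgebra ℚ 𝔸 := NormedAlgebra.restrictScalars ℚ ℝ 𝔸
  exact isUnit_exp X

/-- The monoid generated by the time-`t` flows `exp (t C)`, `t ≥ 0`, of the right-invariant vector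
fields `X ↦ C X` with `C ∈ Γ`. -/
def flowMonoid (Γ : Set 𝔸) : Submonoid 𝔸 :=
  Submonoid.closure {U | ∃ C ∈ Γ, ∃ t : ℝ, 0 ≤ t ∧ exp (t • C) = U}

theorem exp_smul_mem_flowMonoid {Γ : Set 𝔸} {C : 𝔸} (hC : C ∈ Γ) {t : ℝ} (ht : 0 ≤ t) :
    exp (t • C) ∈ flowMonoid Γ :=
  Submonoid.subset_closure ⟨C, hC, t, ht, rfl⟩

theorem isUnit_of_mem_flowMonoid [CompleteSpace 𝔸] {Γ : Set 𝔸} {U : 𝔸} (hU : U ∈ flowMonoid Γ) :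
    IsUnit U := by
  suffices h : flowMonoid Γ ≤ IsUnit.submonoid 𝔸 from h hU
  rw [flowMonoid, Submonoid.closure_le]
  rintro _ ⟨C, -, t, -, rfl⟩
  exact isUnit_exp_of_real _

/-- `V` is a space of velocities of `S` at `g`: some family of points of `S` through `g`, strictly
differentiable at the parameter `0` of `g`, has there a derivative whose range contains `V`. -/
def IsVelocitySpace (S : Set 𝔸) (g : 𝔸) (V : Submodule ℝ 𝔸) : Prop :=
  ∃ (P : Type) (_ : NormedAddCommGroup P) (_ : NormedSpace ℝ P) (_ : CompleteSpace P)
    (F : P → 𝔸) (F' : P →L[ℝ] 𝔸), HasStrictFDerivAt F F' 0 ∧ F 0 = g ∧ (∀ᶠ s in 𝓝 0, F s ∈ S) ∧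
      V ≤ F'.toLinearMap.range

theorem isVelocitySpace_bot {S : Set 𝔸} {g : 𝔸} (hg : g ∈ S) : IsVelocitySpace S g ⊥ :=
  ⟨ℝ, inferInstance, inferInstance, inferInstance, fun _ => g, 0, hasStrictFDerivAt_const g 0, rfl,
    Eventually.of_forall fun _ => hg, bot_le⟩

theorem IsVelocitySpace.mem {S : Set 𝔸} {g : 𝔸} {V : Submodule ℝ 𝔸}
    (hV : IsVelocitySpace S g V) : g ∈ S := by
  obtain ⟨P, _, _, _, F, F', -, rfl, hFS, -⟩ := hV
  exact hFS.self_of_nhds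

theorem IsVelocitySpace.mono {S : Set 𝔸} {g : 𝔸} {V W : Submodule ℝ 𝔸}
    (hV : IsVelocitySpace S g V) (hWV : W ≤ V) : IsVelocitySpace S g W := by
  obtain ⟨P, _, _, _, F, F', hF, hF0, hFS, hFV⟩ := hV
  exact ⟨P, _, _, ‹_›, F, F', hF, hF0, hFS, hWV.trans hFV⟩

theorem IsVelocitySpace.mul_exp [CompleteSpace 𝔸] {S : Submonoid 𝔸} {g h C : 𝔸}
    {V : Submodule ℝ 𝔸} (hV : IsVelocitySpace (S : Set 𝔸) g V)
    (hh : ∀ᶠ t in 𝓝 (0 : ℝ), h * exp (t • C) ∈ S) :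
    IsVelocitySpace (S : Set 𝔸) (g * h)
      (V.map (LinearMap.mulRight ℝ h) ⊔ Submodule.span ℝ {g * h * C}) := by
  obtain ⟨P, _, _, _, F, F', hF, rfl, hFS, hFV⟩ := hV
  have hexp : HasStrictFDerivAt (fun x : P × ℝ => h * exp (x.2 • C)) _ 0 :=
    (HasStrictFDerivAt.comp (g := fun t : ℝ => exp (t • C)) (0 : P × ℝ)
      (hasStrictFDerivAt_exp_smul_const ℝ C 0) hasStrictFDerivAt_snd).const_mul h
  have hFfst : HasStrictFDerivAt (fun x : P × ℝ => F x.1) _ 0 :=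
    HasStrictFDerivAt.comp (g := F) (0 : P × ℝ) hF hasStrictFDerivAt_fst
  refine ⟨P × ℝ, inferInstance, inferInstance, inferInstance,
    fun x => F x.1 * (h * exp (x.2 • C)), _, hFfst.mul' hexp, by simp, ?_, ?_⟩
  · filter_upwards [(continuous_fst.tendsto (0 : P × ℝ)).eventually hFS,
      (continuous_snd.tendsto (0 : P × ℝ)).eventually hh] with x hx hx'
    exact S.mul_mem hx hx'
  · rw [sup_le_iff, Submodule.map_le_iff_le_comap, Submodule.span_singleton_le_iff_mem]
    refine ⟨fun X hX => ?_, ⟨(0, 1), by simp [mul_assoc]⟩⟩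
    obtain ⟨s, rfl⟩ := hFV hX
    exact ⟨(s, 0), by simp⟩

theorem mem_of_hasDerivAt_of_forall_mem {F : Type*} [NormedAddCommGroup F] [NormedSpace ℝ F]
    {V : Submodule ℝ F} [FiniteDimensional ℝ V] {c : ℝ → F} {v : F} {a : ℝ}
    (hc : HasDerivAt c v a) (hV : ∀ t, a ≤ t → c t ∈ V) : v ∈ V := by
  have hclosed : IsClosed (V : Set F) := V.closed_of_finiteDimensional
  refine hclosed.mem_of_tendsto hc.tendsto_slope_zero_right ?_
  filter_upwards [self_mem_nhdsWithin] with t ht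
  exact V.smul_mem _ (V.sub_mem (hV _ (le_add_of_nonneg_right (le_of_lt ht))) (hV a le_rfl))

theorem hasDerivAt_exp_smul_conj_zero [CompleteSpace 𝔸] (C X : 𝔸) :
    HasDerivAt (fun t : ℝ => exp (t • C) * X * exp (-t • C)) (C * X - X * C) 0 := by
  have h := hasDerivAt_exp_smul_const (𝕂 := ℝ) C (0 : ℝ)
  have h' := hasDerivAt_exp_smul_const (𝕂 := ℝ) (-C) (0 : ℝ)
  simp only [smul_neg, ← neg_smul] at h'
  convert (h.mul_const X).fun_mul h' using 1
  simp [-neg_smul, sub_eq_add_neg]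

section FiniteDimensional

variable [FiniteDimensional ℝ 𝔸]

theorem exists_isVelocitySpace_maximal {S : Set 𝔸} (hS : S.Nonempty) :
    ∃ g V, IsVelocitySpace S g V ∧
      ∀ g' V', IsVelocitySpace S g' V' → Module.finrank ℝ V' ≤ Module.finrank ℝ V := by
  set D : Set ℕ := {d | ∃ g V, IsVelocitySpace S g V ∧ Module.finrank ℝ V = d}
  have hbdd : BddAbove D := by
    refine ⟨Module.finrank ℝ 𝔸, ?_⟩
    rintro _ ⟨g, V, -, rfl⟩
    exact V.finrank_le
  obtain ⟨g, hg⟩ := hS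
  obtain ⟨g', V, hV, hVD⟩ : sSup D ∈ D := Nat.sSup_mem ⟨_, g, ⊥, isVelocitySpace_bot hg, rfl⟩ hbdd
  exact ⟨g', V, hV, fun g'' V' hV' => hVD ▸ le_csSup hbdd ⟨g'', V', hV', rfl⟩⟩

variable {Γ : Set 𝔸} {g : 𝔸} {V : Submodule ℝ 𝔸}

theorem mul_mul_mem_map_mulRight_of_maximal (hV : IsVelocitySpace (flowMonoid Γ : Set 𝔸) g V)
    (hmax : ∀ g' V', IsVelocitySpace (flowMonoid Γ : Set 𝔸) g' V' →
      Module.finrank ℝ V' ≤ Module.finrank ℝ V)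
    {C : 𝔸} (hC : C ∈ Γ) {h : 𝔸} (hh : h ∈ flowMonoid Γ) :
    g * h * C ∈ V.map (LinearMap.mulRight ℝ h) := by
  have : CompleteSpace 𝔸 := FiniteDimensional.complete ℝ 𝔸
  -- The velocity of `h * exp C * exp (t C)` at `t = 0` is available for `t` of both signs.
  have hexp : ∀ᶠ t in 𝓝 (0 : ℝ), h * exp C * exp (t • C) ∈ flowMonoid Γ := by
    filter_upwards [eventually_ge_nhds (neg_lt_zero.2 one_pos)] with t ht
    rw [mul_assoc, ← one_smul ℝ C, smul_smul, mul_one, ← exp_add_smul]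
    exact mul_mem hh (exp_smul_mem_flowMonoid hC (by linarith))
  have hunit : IsUnit (h * exp C) := (isUnit_of_mem_flowMonoid hh).mul (isUnit_exp_of_real C)
  have hinj : Function.Injective (LinearMap.mulRight ℝ (h * exp C)) := hunit.mul_left_injective
  have hsup := Submodule.eq_of_le_of_finrank_le (le_sup_left (a := V.map _))
    ((hmax _ _ (hV.mul_exp hexp)).trans (Submodule.equivMapOfInjective _ hinj V).finrank_eq.le)
  have hmem : g * (h * exp C) * C ∈ V.map (LinearMap.mulRight ℝ (h * exp C)) := by
    rw [hsup]
    exact Submodule.mem_sup_right (Submodule.mem_span_singleton_self _)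
  obtain ⟨v, hv, hvC⟩ := hmem
  refine ⟨v, hv, (isUnit_exp_of_real C).mul_left_injective ?_⟩
  simp only [LinearMap.mulRight_apply] at hvC ⊢
  rw [mul_assoc v, hvC, mul_assoc, mul_assoc h, (Commute.refl C).exp_left.eq]
  simp only [mul_assoc]

attribute [local instance] LieRing.ofAssociativeRing

theorem mul_lie_mem_map_mulRight {C X h : 𝔸} (hC : C ∈ Γ) (hh : h ∈ flowMonoid Γ)
    (hX : ∀ k ∈ flowMonoid Γ, g * k * X ∈ V.map (LinearMap.mulRight ℝ k)) :
    g * h * ⁅C, X⁆ ∈ V.map (LinearMap.mulRight ℝ h) := by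
  have : CompleteSpace 𝔸 := FiniteDimensional.complete ℝ 𝔸
  refine mem_of_hasDerivAt_of_forall_mem ((hasDerivAt_exp_smul_conj_zero C X).const_mul (g * h))
    fun t ht => ?_
  obtain ⟨v, hv, hvX⟩ := hX _ (mul_mem hh (exp_smul_mem_flowMonoid hC ht))
  refine ⟨v, hv, ?_⟩
  calc v * h = v * (h * exp (t • C)) * exp (-t • C) := by
        rw [mul_assoc, mul_assoc h, exp_smul_mul_exp_neg_smul, mul_one]
    _ = g * (h * exp (t • C)) * X * exp (-t • C) := by rw [← hvX, LinearMap.mulRight_apply]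
    _ = g * h * (exp (t • C) * X * exp (-t • C)) := by simp only [mul_assoc]

theorem exists_isVelocitySpace_lieSpan (Γ : Set 𝔸) :
    ∃ g, IsVelocitySpace (flowMonoid Γ : Set 𝔸) g
      ((LieSubalgebra.lieSpan ℝ 𝔸 Γ).toSubmodule.map (LinearMap.mulLeft ℝ g)) := by
  obtain ⟨g, V, hV, hmax⟩ :=
    exists_isVelocitySpace_maximal (S := (flowMonoid Γ : Set 𝔸)) ⟨1, one_mem _⟩
  set W : Submodule ℝ 𝔸 := ⨅ h ∈ flowMonoid Γ,
    (V.map (LinearMap.mulRight ℝ h)).comap (LinearMap.mulLeft ℝ (g * h)) with hW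
  have hmemW {X : 𝔸} :
      X ∈ W ↔ ∀ h ∈ flowMonoid Γ, g * h * X ∈ V.map (LinearMap.mulRight ℝ h) := by
    simp only [hW, Submodule.mem_iInf, Submodule.mem_comap, LinearMap.mulLeft_apply]
  have hle : (LieSubalgebra.lieSpan ℝ 𝔸 Γ).toSubmodule ≤ W :=
    lieSpan_toSubmodule_le
      (fun C hC => hmemW.2 fun h hh => mul_mul_mem_map_mulRight_of_maximal hV hmax hC hh)
      (fun C hC X hX => hmemW.2 fun h hh => mul_lie_mem_map_mulRight hC hh (hmemW.1 hX))
  refine ⟨g, hV.mono ?_⟩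
  rintro _ ⟨X, hX, rfl⟩
  simpa using hmemW.1 (hle hX) 1 (one_mem _)

end FiniteDimensional

end Accessibility

section LocalTransitivity

variable {𝔸 : Type*} [NormedRing 𝔸] [NormedAlgebra ℝ 𝔸]

theorem IsVelocitySpace.mem_nhdsWithin [FiniteDimensional ℝ 𝔸] {S : Set 𝔸} {G : Submonoid 𝔸}
    {𝔤 : Submodule ℝ 𝔸} {g : 𝔸}
    (hV : IsVelocitySpace S g (𝔤.map (LinearMap.mulLeft ℝ g))) (hSG : S ⊆ G) (hg : IsUnit g)
    (hG : ∀ᶠ Z in 𝓝 (0 : 𝔸), exp Z ∈ G → Z ∈ 𝔤)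
    (hcancel : ∀ a ∈ G, ∀ b, a * b ∈ G → b ∈ G) : S ∈ 𝓝[G] g := by
  have : CompleteSpace 𝔸 := FiniteDimensional.complete ℝ 𝔸
  obtain ⟨𝔢, h𝔢⟩ := 𝔤.exists_isCompl
  obtain ⟨P, _, _, _, F, F', hF, rfl, hFS, hFV⟩ := hV
  -- `F s * exp Z`, with `Z` transverse to `𝔤`, covers a neighbourhood of `F 0` in `𝔸`; its value
  -- can only lie in `G` if `Z = 0`.
  set Φ : P × 𝔢 → 𝔸 := fun x => F x.1 * exp (x.2 : 𝔸) with hΦ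
  have hexp : HasStrictFDerivAt (fun x : P × 𝔢 => exp (x.2 : 𝔸)) _ 0 :=
    HasStrictFDerivAt.comp (g := exp) (0 : P × 𝔢) (hasStrictFDerivAt_exp_zero (𝕂 := ℝ))
      (𝔢.subtypeL.hasStrictFDerivAt.comp (0 : P × 𝔢) hasStrictFDerivAt_snd)
  have hFfst : HasStrictFDerivAt (fun x : P × 𝔢 => F x.1) _ 0 :=
    HasStrictFDerivAt.comp (g := F) (0 : P × 𝔢) hF hasStrictFDerivAt_fst
  have hΦ0 : Φ 0 = F 0 := by simp [hΦ]
  have hmap : map Φ (𝓝 0) = 𝓝 (Φ 0) := by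
    refine (hFfst.mul' hexp).map_nhds_eq_of_surj (LinearMap.range_eq_top.2 fun Y => ?_)
    obtain ⟨X, rfl⟩ := (IsUnit.isUnit_iff_mulLeft_bijective.1 hg).surjective Y
    obtain ⟨X₁, hX₁, X₂, hX₂, rfl⟩ :=
      Submodule.mem_sup.1 (h𝔢.sup_eq_top.ge (Submodule.mem_top (x := X)))
    obtain ⟨s, hs⟩ := hFV ⟨X₁, hX₁, rfl⟩
    refine ⟨(s, ⟨X₂, hX₂⟩), ?_⟩
    simpa [mul_add, add_comm] using congrArg (F 0 * X₂ + ·) hs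
  have hsnd : Tendsto (fun x : P × 𝔢 => (x.2 : 𝔸)) (𝓝 0) (𝓝 0) :=
    (continuous_subtype_val.comp continuous_snd).tendsto' _ _ rfl
  have himage := image_mem_map (m := Φ)
    (((continuous_fst.tendsto (0 : P × 𝔢)).eventually hFS).and (hsnd.eventually hG))
  rw [hmap, hΦ0] at himage
  filter_upwards [mem_nhdsWithin_of_mem_nhds himage, self_mem_nhdsWithin] with U hU hUG
  obtain ⟨⟨s, Z⟩, ⟨hs, hZ⟩, rfl⟩ := hU
  have hZ0 : (Z : 𝔸) = 0 :=
    Submodule.disjoint_def.1 h𝔢.disjoint Z (hZ (hcancel _ (hSG hs) _ hUG)) Z.2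
  simpa [hΦ, hZ0] using hs

theorem eventually_eq_of_exp_eq_exp [CompleteSpace 𝔸] :
    ∀ᶠ p in 𝓝 ((0 : 𝔸), (0 : 𝔸)), exp p.1 = exp p.2 → p.1 = p.2 := by
  have h : HasStrictFDerivAt exp ((ContinuousLinearEquiv.refl ℝ 𝔸 : 𝔸 ≃L[ℝ] 𝔸) : 𝔸 →L[ℝ] 𝔸) 0 :=
    hasStrictFDerivAt_exp_zero
  have hleft := h.eventually_left_inverse
  rw [nhds_prod_eq]
  filter_upwards [hleft.prod_mk hleft] with p hp hexp
  rw [← hp.1, ← hp.2, hexp]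

end LocalTransitivity

theorem mem_nhds_one_of_mem_nhds {G : Type*} [Group G] [TopologicalSpace G] [IsTopologicalGroup G]
    [CompactSpace G] {S : Submonoid G} {g : G} (hS : (S : Set G) ∈ 𝓝 g) : (S : Set G) ∈ 𝓝 1 := by
  -- In a compact group, some power `g ^ n` is so close to `g⁻¹` that `S` is a neighbourhood of its
  -- inverse; then `g ^ n • S ⊆ S` is a neighbourhood of `1`.
  have hinv : ∀ᶠ y in 𝓝 g⁻¹, (S : Set G) ∈ 𝓝 y⁻¹ :=
    (continuous_inv.tendsto' g⁻¹ g (inv_inv g)).eventually (eventually_mem_nhds_iff.2 hS)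
  obtain ⟨n, hn⟩ := ((mapClusterPt_inv_atTop_pow.2
    (mapClusterPt_self_atTop_pow g)).frequently hinv).exists
  have hmul : Tendsto (fun x => (g ^ n)⁻¹ * x) (𝓝 1) (𝓝 (g ^ n)⁻¹) :=
    (continuous_const_mul _).tendsto' _ _ (mul_one _)
  filter_upwards [hmul.eventually_mem hn] with x hx
  simpa using S.mul_mem (S.pow_mem (mem_of_mem_nhds hS) n) hx

section SpecialUnitary

open scoped Matrix.Norms.L2Operator

theorem eventually_star_eq_neg_of_exp_mem_unitary {𝔸 : Type*} [NormedRing 𝔸] [NormedAlgebra ℝ 𝔸]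
    [CompleteSpace 𝔸] [StarRing 𝔸] [ContinuousStar 𝔸] :
    ∀ᶠ X in 𝓝 (0 : 𝔸), exp X ∈ unitary 𝔸 → star X = -X := by
  have hcont : Tendsto (fun X : 𝔸 => (star X, -X)) (𝓝 0) (𝓝 (0, 0)) :=
    (continuous_star.prodMk continuous_neg).tendsto' _ _ (by simp)
  filter_upwards [hcont.eventually eventually_eq_of_exp_eq_exp] with X hX hunitary
  refine hX (left_inv_eq_right_inv (a := exp X) ?_ ?_)
  · rw [← star_exp, Unitary.star_mul_self_of_mem hunitary]
  · simpa using exp_smul_mul_exp_neg_smul 1 X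

variable {n : Type*} [Fintype n] [DecidableEq n] {N : ℕ}

theorem diagonal_mul_I_mem_su {θ : Fin N → ℝ} (hθ : ∑ j, θ j = 0) :
    Matrix.diagonal (fun j => θ j * Complex.I) ∈ su N := by
  refine ⟨?_, ?_⟩
  · rw [Matrix.diagonal_conjTranspose, Matrix.diagonal_neg]
    congr 1
    ext j
    simp
  · rw [Matrix.trace_diagonal, ← Finset.sum_mul, ← Complex.ofReal_sum, hθ, Complex.ofReal_zero,
      zero_mul]

theorem conj_mem_su {V X : Matrix (Fin N) (Fin N) ℂ} (hV : V ∈ Matrix.unitaryGroup (Fin N) ℂ)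
    (hX : X ∈ su N) : V * X * star V ∈ su N := by
  refine ⟨?_, ?_⟩
  · rw [Matrix.star_eq_conjTranspose, Matrix.conjTranspose_mul, Matrix.conjTranspose_mul,
      Matrix.conjTranspose_conjTranspose, hX.1, neg_mul, mul_neg, mul_assoc]
  · rw [Matrix.trace_mul_cycle, Unitary.star_mul_self_of_mem hV, one_mul, hX.2]

theorem exp_conj_diagonal {V : Matrix n n ℂ} (hV : V ∈ Matrix.unitaryGroup n ℂ)
    (d : n → ℂ) : exp (V * Matrix.diagonal d * star V) =
      V * Matrix.diagonal (fun j => Complex.exp (d j)) * star V := by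
  have hinv : V⁻¹ = star V := Matrix.inv_eq_right_inv (Unitary.mul_star_self_of_mem hV)
  have hunit : IsUnit V := IsUnit.of_mul_eq_one _ (Unitary.mul_star_self_of_mem hV)
  have hexp : exp d = fun j => Complex.exp (d j) :=
    funext fun j => by rw [Pi.coe_exp, Complex.exp_eq_exp_ℂ]
  rw [← hinv, Matrix.exp_conj _ _ hunit, Matrix.exp_diagonal, hexp]

theorem exists_eq_conj_diagonal {X : Matrix n n ℂ} (hX : Xᴴ = -X) :
    ∃ V ∈ Matrix.unitaryGroup n ℂ, ∃ θ : n → ℝ,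
      X = V * Matrix.diagonal (fun j => θ j * Complex.I) * star V := by
  have hH : (-Complex.I • X).IsHermitian := by
    rw [Matrix.IsHermitian, Matrix.conjTranspose_smul, hX]
    simp
  refine ⟨hH.eigenvectorUnitary, hH.eigenvectorUnitary.2, hH.eigenvalues, ?_⟩
  have hspec := hH.spectral_theorem
  rw [Unitary.conjStarAlgAut_apply] at hspec
  have hdiag : Matrix.diagonal (fun j => hH.eigenvalues j * Complex.I) =
      Complex.I • Matrix.diagonal (RCLike.ofReal ∘ hH.eigenvalues : n → ℂ) := by
    rw [← Matrix.diagonal_smul]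
    congr 1
    ext j
    simp [mul_comm]
  rw [hdiag, Matrix.mul_smul, Matrix.smul_mul, ← hspec, smul_smul]
  simp

theorem det_conj_diagonal {V : Matrix n n ℂ} (hV : V ∈ Matrix.unitaryGroup n ℂ)
    (d : n → ℂ) : (V * Matrix.diagonal d * star V).det = ∏ j, d j := by
  rw [Matrix.det_mul_right_comm, Unitary.mul_star_self_of_mem hV, one_mul, Matrix.det_diagonal]

theorem det_exp_of_conjTranspose_eq_neg {X : Matrix n n ℂ} (hX : Xᴴ = -X) :
    (exp X).det = Complex.exp X.trace := by
  obtain ⟨V, hV, θ, rfl⟩ := exists_eq_conj_diagonal hX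
  rw [exp_conj_diagonal hV, det_conj_diagonal hV, Matrix.trace_mul_cycle,
    Unitary.star_mul_self_of_mem hV, one_mul, Matrix.trace_diagonal, Complex.exp_sum]

theorem exp_mem_specialUnitaryGroup {X : Matrix (Fin N) (Fin N) ℂ} (hX : X ∈ su N) :
    exp X ∈ Matrix.specialUnitaryGroup (Fin N) ℂ := by
  let _ : NormedAlgebra ℚ (Matrix (Fin N) (Fin N) ℂ) := NormedAlgebra.restrictScalars ℚ ℂ _
  refine Matrix.mem_specialUnitaryGroup_iff.2
    ⟨exp_mem_unitary_of_mem_skewAdjoint (skewAdjoint.mem_iff.2 hX.1), ?_⟩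
  rw [det_exp_of_conjTranspose_eq_neg hX.1, hX.2, Complex.exp_zero]

theorem eventually_mem_su_of_exp_mem : ∀ᶠ X in 𝓝 (0 : Matrix (Fin N) (Fin N) ℂ),
    exp X ∈ Matrix.specialUnitaryGroup (Fin N) ℂ → X ∈ su N := by
  have htrace : Tendsto (fun X : Matrix (Fin N) (Fin N) ℂ => (X.trace, (0 : ℂ))) (𝓝 0)
      (𝓝 (0, 0)) :=
    ((continuous_id.matrix_trace).prodMk continuous_const).tendsto' _ _ (by simp)
  filter_upwards [eventually_star_eq_neg_of_exp_mem_unitary,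
    htrace.eventually eventually_eq_of_exp_eq_exp] with X hstar htr hX
  obtain ⟨hunitary, hdet⟩ := Matrix.mem_specialUnitaryGroup_iff.1 hX
  have hskew : Xᴴ = -X := hstar hunitary
  refine ⟨hskew, htr ?_⟩
  rw [← Complex.exp_eq_exp_ℂ, ← det_exp_of_conjTranspose_eq_neg hskew, hdet, Complex.exp_zero]

theorem exists_exp_eq_of_mem_unitaryGroup {U : Matrix n n ℂ}
    (hU : U ∈ Matrix.unitaryGroup n ℂ) :
    ∃ X : Matrix n n ℂ, Xᴴ = -X ∧ exp X = U := by
  have hnormal : IsStarNormal U := ⟨by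
    rw [Commute, SemiconjBy, Unitary.star_mul_self_of_mem hU, Unitary.mul_star_self_of_mem hU]⟩
  have hcont (f : ℂ → ℂ) : ContinuousOn f (spectrum ℂ U) := U.finite_spectrum.continuousOn f
  have harg : IsSelfAdjoint (cfc (fun z : ℂ => (z.arg : ℂ)) U) := IsSelfAdjoint.cfc_arg U
  refine ⟨Complex.I • cfc (fun z : ℂ => (z.arg : ℂ)) U, ?_, ?_⟩
  · rw [Matrix.conjTranspose_smul, ← Matrix.star_eq_conjTranspose, harg.star_eq]
    simp
  rw [← CFC.exp_eq_normedSpace_exp (𝕜 := ℂ), ← cfc_comp_smul (hf := Continuous.continuousOn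
    (by fun_prop)), ← cfc_comp' (hf := hcont _) (hg := Continuous.continuousOn (by fun_prop))]
  conv_rhs => rw [← cfc_id' ℂ U]
  refine cfc_congr fun z hz => ?_
  have hnorm : ‖z‖ = 1 := spectrum.norm_eq_one_of_unitary hU hz
  have hlog : Complex.I * z.arg = Complex.log z :=
    Complex.ext (by simp [Complex.log_re, hnorm]) (by simp [Complex.log_im])
  have hz0 : z ≠ 0 := norm_ne_zero_iff.1 (hnorm ▸ one_ne_zero)
  simpa [← Complex.exp_eq_exp_ℂ, hlog] using Complex.exp_log hz0

theorem exists_eq_conj_diagonal_of_mem_unitaryGroup {U : Matrix n n ℂ}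
    (hU : U ∈ Matrix.unitaryGroup n ℂ) :
    ∃ V ∈ Matrix.unitaryGroup n ℂ, ∃ θ : n → ℝ,
      U = V * Matrix.diagonal (fun j => Complex.exp (θ j * Complex.I)) * star V := by
  obtain ⟨X, hX, rfl⟩ := exists_exp_eq_of_mem_unitaryGroup hU
  obtain ⟨V, hV, θ, rfl⟩ := exists_eq_conj_diagonal hX
  exact ⟨V, hV, θ, exp_conj_diagonal hV _⟩

theorem exists_exp_eq_of_mem_specialUnitaryGroup {U : Matrix (Fin N) (Fin N) ℂ}
    (hU : U ∈ Matrix.specialUnitaryGroup (Fin N) ℂ) : ∃ X ∈ su N, exp X = U := by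
  rcases N.eq_zero_or_pos with rfl | hN
  · exact ⟨0, zero_mem _, Subsingleton.elim _ _⟩
  obtain ⟨hunitary, hdet⟩ := Matrix.mem_specialUnitaryGroup_iff.1 hU
  obtain ⟨V, hV, θ, rfl⟩ := exists_eq_conj_diagonal_of_mem_unitaryGroup hunitary
  obtain ⟨m, hm⟩ : ∃ m : ℤ, ∑ j, θ j = m * (2 * Real.pi) := by
    rw [det_conj_diagonal hV, ← Complex.exp_sum, ← Finset.sum_mul, Complex.exp_eq_one_iff] at hdet
    obtain ⟨m, hm⟩ := hdet
    refine ⟨m, Complex.ofReal_injective (mul_right_cancel₀ Complex.I_ne_zero ?_)⟩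
    push_cast
    rw [hm]
    ring
  set θ' : Fin N → ℝ := θ - Pi.single ⟨0, hN⟩ (m * (2 * Real.pi)) with hθ'
  have hsum : ∑ j, θ' j = 0 := by simp [hθ', hm]
  have hexp (j : Fin N) : Complex.exp (θ' j * Complex.I) = Complex.exp (θ j * Complex.I) := by
    rcases eq_or_ne j ⟨0, hN⟩ with rfl | hj
    · rw [← Complex.exp_periodic.sub_int_mul_eq (x := θ ⟨0, hN⟩ * Complex.I) m]
      simp only [hθ', Pi.sub_apply, Pi.single_eq_same]
      push_cast
      ring_nf
    · simp [hθ', hj]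
  refine ⟨_, conj_mem_su hV (diagonal_mul_I_mem_su hsum), ?_⟩
  simp only [exp_conj_diagonal hV, hexp]

instance : IsTopologicalGroup (Matrix.specialUnitaryGroup n ℂ) where
  continuous_inv := (continuous_star.comp continuous_subtype_val).subtype_mk _

theorem isClosed_specialUnitaryGroup :
    IsClosed (Matrix.specialUnitaryGroup n ℂ : Set (Matrix n n ℂ)) := by
  have h : (Matrix.specialUnitaryGroup n ℂ : Set (Matrix n n ℂ)) =
      {U | U * star U = 1} ∩ {U | U.det = 1} := by
    ext U
    simp [Matrix.mem_specialUnitaryGroup_iff, Matrix.mem_unitaryGroup_iff]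
  rw [h]
  exact (isClosed_eq (by fun_prop) continuous_const).inter
    (isClosed_eq (Continuous.matrix_det continuous_id) continuous_const)

theorem norm_le_one_of_mem_unitary {𝔸 : Type*} [NormedRing 𝔸] [StarRing 𝔸] [CStarRing 𝔸] {U : 𝔸}
    (hU : U ∈ unitary 𝔸) : ‖U‖ ≤ 1 := by
  rcases subsingleton_or_nontrivial 𝔸 with h | h
  · rw [Subsingleton.elim U 0, norm_zero]
    exact zero_le_one
  · exact (CStarRing.norm_of_mem_unitary hU).le

instance : CompactSpace (Matrix.specialUnitaryGroup n ℂ) := by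
  refine isCompact_iff_compactSpace.1 (Metric.isCompact_of_isClosed_isBounded
    isClosed_specialUnitaryGroup ?_)
  exact (Metric.isBounded_closedBall (x := 0) (r := 1)).subset fun U hU => by
    simpa using norm_le_one_of_mem_unitary (Matrix.specialUnitaryGroup_le_unitaryGroup hU)

theorem mem_specialUnitaryGroup_of_mul_mem {a : Matrix n n ℂ}
    (ha : a ∈ Matrix.specialUnitaryGroup n ℂ) (b : Matrix n n ℂ)
    (hab : a * b ∈ Matrix.specialUnitaryGroup n ℂ) :
    b ∈ Matrix.specialUnitaryGroup n ℂ := by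
  have hstar : star a ∈ Matrix.specialUnitaryGroup n ℂ :=
    (⟨a, ha⟩⁻¹ : Matrix.specialUnitaryGroup n ℂ).2
  have hunitary := Matrix.specialUnitaryGroup_le_unitaryGroup ha
  simpa only [← mul_assoc, Unitary.star_mul_self_of_mem hunitary, one_mul] using mul_mem hstar hab

theorem eq_top_of_mem_nhds_one {S : Submonoid (Matrix.specialUnitaryGroup (Fin N) ℂ)}
    (hS : (S : Set (Matrix.specialUnitaryGroup (Fin N) ℂ)) ∈ 𝓝 1) : S = ⊤ := by
  let _ : NormedAlgebra ℚ (Matrix (Fin N) (Fin N) ℂ) := NormedAlgebra.restrictScalars ℚ ℂ _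
  rw [eq_top_iff]
  rintro U -
  obtain ⟨X, hX, hXU⟩ := exists_exp_eq_of_mem_specialUnitaryGroup U.2
  set c : ℝ → Matrix.specialUnitaryGroup (Fin N) ℂ :=
    fun t => ⟨exp (t • X), exp_mem_specialUnitaryGroup ((su N).smul_mem t hX)⟩ with hc
  have hcont : Tendsto c (𝓝 0) (𝓝 1) := by
    refine Continuous.tendsto' ?_ _ _ (Subtype.ext (by simp [hc]))
    exact (exp_continuous.comp (continuous_id.smul continuous_const)).subtype_mk _
  obtain ⟨n, hn⟩ :=
    ((hcont.comp tendsto_one_div_add_atTop_nhds_zero_nat).eventually_mem hS).exists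
  have hU : U = c (1 / ((n : ℝ) + 1)) ^ (n + 1) := by
    ext1
    rw [SubmonoidClass.coe_pow, hc, ← exp_nsmul, ← hXU, ← Nat.cast_smul_eq_nsmul ℝ, smul_smul]
    congr 1
    rw [Nat.cast_succ, mul_one_div_cancel (Nat.cast_add_one_ne_zero n), one_smul]
  exact hU ▸ S.pow_mem hn _

attribute [local instance] LieRing.ofAssociativeRing

theorem flowMonoid_eq_specialUnitaryGroup {Γ : Set (Matrix (Fin N) (Fin N) ℂ)} (hΓ : Γ ⊆ su N)
    (hgen : su N ≤ (LieSubalgebra.lieSpan ℝ (Matrix (Fin N) (Fin N) ℂ) Γ).toSubmodule) :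
    flowMonoid Γ = Matrix.specialUnitaryGroup (Fin N) ℂ := by
  have hle : flowMonoid Γ ≤ Matrix.specialUnitaryGroup (Fin N) ℂ := by
    rw [flowMonoid, Submonoid.closure_le]
    rintro _ ⟨C, hC, t, -, rfl⟩
    exact exp_mem_specialUnitaryGroup ((su N).smul_mem t (hΓ hC))
  obtain ⟨g, hV⟩ := exists_isVelocitySpace_lieSpan Γ
  have hnhds := (hV.mono (Submodule.map_mono hgen)).mem_nhdsWithin hle
    (isUnit_of_mem_flowMonoid hV.mem) eventually_mem_su_of_exp_mem
    (fun _ => mem_specialUnitaryGroup_of_mul_mem)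
  set S := (flowMonoid Γ).comap (Matrix.specialUnitaryGroup (Fin N) ℂ).subtype
  have hS : (S : Set (Matrix.specialUnitaryGroup (Fin N) ℂ)) ∈ 𝓝 ⟨g, hle hV.mem⟩ :=
    (preimage_coe_mem_nhds_subtype (a := ⟨g, hle hV.mem⟩)).2 hnhds
  have htop : S = ⊤ := eq_top_of_mem_nhds_one (mem_nhds_one_of_mem_nhds hS)
  exact le_antisymm hle fun U hU => htop.ge (Submonoid.mem_top ⟨U, hU⟩)

end SpecialUnitary

section Concatenation

variable {α : Type*}

/-- The curve that follows `f` up to time `T` and then `g`, restarted at time `T`. -/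
noncomputable def concat (T : ℝ) (f g : ℝ → α) (t : ℝ) : α :=
  if t ≤ T then f t else g (t - T)

theorem concat_of_le {T t : ℝ} (f g : ℝ → α) (ht : t ≤ T) : concat T f g t = f t :=
  if_pos ht

theorem concat_of_lt {T t : ℝ} (f g : ℝ → α) (ht : T < t) : concat T f g t = g (t - T) :=
  if_neg ht.not_ge

theorem concat_of_ge {T t : ℝ} {f g : ℝ → α} (hfg : f T = g 0) (ht : T ≤ t) :
    concat T f g t = g (t - T) := by
  rcases ht.eq_or_lt with rfl | ht
  · rw [concat_of_le f g le_rfl, hfg, sub_self]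
  · exact concat_of_lt f g ht

theorem concat_eventuallyEq_left {T t : ℝ} (f g : ℝ → α) (ht : t < T) :
    concat T f g =ᶠ[𝓝 t] f := by
  filter_upwards [eventually_lt_nhds ht] with s hs
  exact concat_of_le f g hs.le

theorem concat_eventuallyEq_right {T t : ℝ} (f g : ℝ → α) (ht : T < t) :
    concat T f g =ᶠ[𝓝 t] fun s => g (s - T) := by
  filter_upwards [eventually_gt_nhds ht] with s hs
  exact concat_of_lt f g hs

theorem continuousOn_concat [TopologicalSpace α] {f g : ℝ → α} {S T : ℝ} (hS : 0 ≤ S) (hT : 0 ≤ T)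
    (hf : ContinuousOn f (Set.Icc 0 S)) (hg : ContinuousOn g (Set.Icc 0 T)) (hfg : f S = g 0) :
    ContinuousOn (concat S f g) (Set.Icc 0 (S + T)) := by
  have hleft : ContinuousOn (concat S f g) (Set.Icc 0 S) :=
    hf.congr fun t ht => concat_of_le f g ht.2
  have hright : ContinuousOn (concat S f g) (Set.Icc S (S + T)) := by
    refine (hg.comp (continuous_sub_right S).continuousOn fun t ht => ?_).congr
      fun t ht => concat_of_ge hfg ht.1
    exact ⟨sub_nonneg.2 ht.1, sub_le_iff_le_add'.2 ht.2⟩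
  rw [← Set.Icc_union_Icc_eq_Icc hS (le_add_of_nonneg_right hT)]
  exact hleft.union_of_isClosed hright isClosed_Icc isClosed_Icc

theorem forall_mem_Icc_concat {p : α → Prop} {f g : ℝ → α} {S T : ℝ}
    (hf : ∀ t ∈ Set.Icc 0 S, p (f t)) (hg : ∀ t ∈ Set.Icc 0 T, p (g t)) :
    ∀ t ∈ Set.Icc 0 (S + T), p (concat S f g t) := by
  rintro t ⟨ht0, htT⟩
  rcases le_or_gt t S with ht | ht
  · rw [concat_of_le f g ht]
    exact hf t ⟨ht0, ht⟩
  · rw [concat_of_lt f g ht]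
    exact hg _ ⟨sub_nonneg.2 ht.le, sub_le_iff_le_add'.2 htT⟩

end Concatenation

section Reachability

open scoped Matrix.Norms.L2Operator

variable {N : ℕ} {A B : Matrix (Fin N) (Fin N) ℂ}

theorem isTrajectory_exp {c : ℝ} (hc : A + c • B ∈ su N) (T : ℝ) :
    IsTrajectory A B T (fun _ => c) (fun t => exp (t • (A + c • B))) := by
  have hderiv (t : ℝ) : HasDerivAt (fun t : ℝ => exp (t • (A + c • B)))
      ((A + c • B) * exp (t • (A + c • B))) t := hasDerivAt_exp_smul_const' (A + c • B) t
  exact ⟨fun t _ => (hderiv t).continuousAt.continuousWithinAt,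
    fun t _ => exp_mem_specialUnitaryGroup ((su N).smul_mem t hc), by simp,
    ∅, fun t _ _ => ⟨Eventually.of_forall fun _ => rfl, hderiv t⟩⟩

theorem IsTrajectory.concat {S T : ℝ} (hS : 0 ≤ S) (hT : 0 ≤ T) {u v : ℝ → ℝ}
    {X Y : ℝ → Matrix (Fin N) (Fin N) ℂ} (hX : IsTrajectory A B S u X)
    (hY : IsTrajectory A B T v Y) :
    IsTrajectory A B (S + T) (concat S u v) (concat S X fun t => Y t * X S) := by
  obtain ⟨hXcont, hXmem, hX0, J, hXeq⟩ := hX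
  obtain ⟨hYcont, hYmem, hY0, K, hYeq⟩ := hY
  have hXS := hXmem S ⟨hS, le_rfl⟩
  refine ⟨continuousOn_concat hS hT hXcont (hYcont.mul continuousOn_const) (by simp [hY0]),
    forall_mem_Icc_concat hXmem fun t ht => mul_mem (hYmem t ht) hXS,
    (concat_of_le _ _ hS).trans hX0, insert S (J ∪ K.image (S + ·)), fun t ht htJK => ?_⟩
  simp only [Finset.mem_insert, Finset.mem_union, Finset.mem_image, not_or] at htJK
  obtain ⟨htS, htJ, htK⟩ := htJK
  rcases lt_or_gt_of_ne htS with hlt | hgt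
  · obtain ⟨hu, hderiv⟩ := hXeq t ⟨ht.1, hlt⟩ htJ
    rw [concat_of_le _ _ hlt.le, concat_of_le _ _ hlt.le]
    refine ⟨?_, hderiv.congr_of_eventuallyEq (concat_eventuallyEq_left _ _ hlt)⟩
    filter_upwards [hu, concat_eventuallyEq_left u v hlt] with s hs hconcat
    rw [hconcat, hs]
  · have htK' : t - S ∉ K := fun h => htK ⟨t - S, h, add_sub_cancel S t⟩
    obtain ⟨hv, hderiv⟩ := hYeq (t - S) ⟨sub_pos.2 hgt, sub_lt_iff_lt_add'.2 ht.2⟩ htK'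
    rw [concat_of_lt _ _ hgt, concat_of_lt _ _ hgt, ← mul_assoc]
    refine ⟨?_, ((hderiv.comp_sub_const t S).mul_const (X S)).congr_of_eventuallyEq
      (concat_eventuallyEq_right _ _ hgt)⟩
    filter_upwards [((continuous_sub_right S).tendsto t).eventually hv,
      concat_eventuallyEq_right u v hgt] with s hs hconcat
    rw [hconcat, hs]

/-- The reachable set as a submonoid of `SU(N)`: steering to `U` and then restarting the input
that steers to `V` reaches `V * U`. -/
def reachableSubmonoid (A B : Matrix (Fin N) (Fin N) ℂ) :
    Submonoid (Matrix.specialUnitaryGroup (Fin N) ℂ) where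
  carrier := reachableSet A B
  one_mem' := ⟨0, le_rfl, 0, 1, ⟨continuousOn_const, fun _ _ => one_mem _, rfl, ∅,
    fun _ ht => absurd (ht.1.trans ht.2) (lt_irrefl 0)⟩, rfl⟩
  mul_mem' := by
    rintro V U ⟨T, hT, v, Y, hY, hYT⟩ ⟨S, hS, u, X, hX, hXS⟩
    refine ⟨S + T, add_nonneg hS hT, _, _, hX.concat hS hT hY, ?_⟩
    rw [concat_of_ge (by rw [hY.2.2.1, one_mul]) (le_add_of_nonneg_right hT), add_sub_cancel_left,
      hYT, hXS, Submonoid.coe_mul]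

theorem flowMonoid_le_map_reachableSubmonoid (hA : A ∈ su N) (hB : B ∈ su N) :
    flowMonoid (Set.range fun c : ℝ => A + c • B) ≤
      (reachableSubmonoid A B).map (Matrix.specialUnitaryGroup (Fin N) ℂ).subtype := by
  rw [flowMonoid, Submonoid.closure_le]
  rintro _ ⟨_, ⟨c, rfl⟩, t, ht, rfl⟩
  have hc : A + c • B ∈ su N := (su N).add_mem hA ((su N).smul_mem c hB)
  exact ⟨⟨_, exp_mem_specialUnitaryGroup ((su N).smul_mem t hc)⟩,
    ⟨t, ht, _, _, isTrajectory_exp hc t, rfl⟩, rfl⟩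

attribute [local instance] LieRing.ofAssociativeRing

theorem controllable_of_su_le_lieSpan (hA : A ∈ su N) (hB : B ∈ su N)
    (hgen : su N ≤ (LieSubalgebra.lieSpan ℝ (Matrix (Fin N) (Fin N) ℂ) {A, B}).toSubmodule) :
    Controllable A B := by
  set Γ : Set (Matrix (Fin N) (Fin N) ℂ) := Set.range fun c : ℝ => A + c • B
  have hΓsu : Γ ⊆ su N := by
    rintro _ ⟨c, rfl⟩
    exact (su N).add_mem hA ((su N).smul_mem c hB)
  have hAΓ : A ∈ LieSubalgebra.lieSpan ℝ _ Γ := LieSubalgebra.subset_lieSpan ⟨0, by simp⟩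
  have hABΓ : A + B ∈ LieSubalgebra.lieSpan ℝ _ Γ := LieSubalgebra.subset_lieSpan ⟨1, by simp⟩
  have hle : LieSubalgebra.lieSpan ℝ _ {A, B} ≤ LieSubalgebra.lieSpan ℝ _ Γ := by
    refine LieSubalgebra.lieSpan_le.2 (Set.pair_subset hAΓ ?_)
    simpa using sub_mem hABΓ hAΓ
  have htop := flowMonoid_eq_specialUnitaryGroup hΓsu (hgen.trans hle)
  refine Set.eq_univ_of_forall fun U => ?_
  obtain ⟨U', hU', hUU'⟩ := flowMonoid_le_map_reachableSubmonoid hA hB (htop.ge U.2)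
  rwa [← Subtype.ext hUU']

end Reachability

theorem drift_mem_su {N : ℕ} {E : Fin N → ℝ} (hE : ∑ i, E i = 0) : drift E ∈ su N := by
  convert diagonal_mul_I_mem_su (θ := -E) (by simp [hE]) using 1
  simp [drift, mul_comm]

end QuantumControl

open QuantumControl in
theorem mainTheorem2_general (N : ℕ) (E : Fin N → ℝ) (hE : ∑ i, E i = 0)
    (B : Matrix (Fin N) (Fin N) ℂ) (hB : B ∈ su N) (hconn : GraphConnected B)
    (hdist : HasDistinctTransitions E B) : Controllable (drift E) B :=
  controllable_of_su_le_lieSpan (drift_mem_su hE) hB <|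
    su_le_lieSpan_drift hdist hB.1 hconn

theorem mainTheorem2 (N : ℕ) (E : Fin N → ℝ) (hE : ∑ i, E i = 0)
    (B : Matrix (Fin N) (Fin N) ℂ) (hB : B ∈ QuantumControl.su N)
    (hconn : QuantumControl.GraphConnected B) (hreg : QuantumControl.IsRegularDrift E) :
    QuantumControl.Controllable (QuantumControl.drift E) B :=
  mainTheorem2_general N E hE B hB hconn fun i j k l hij hkl _ _ => hreg.2 i j k l hij hkl
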